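/- Let $n,d_1,d_2$ be positive integers, $d=\min\{d_1,d_2\}$, and for $A\in\mathbb{R}^{d_1\times d_2}$ let $\sigma_1(A)\ge\dots\ge\sigma_d(A)\ge 0$ be its singular values, $\|A\|_*=\sum_j\sigma_j(A)$ the nuclear norm, $\|A\|_{\rm op}=\sigma_1(A)$, $\|A\|_F$ the Frobenius norm, and $\langle A,B\rangle=\mathrm{trace}(A^\top B)$. Let $q\in[0,1]$, let $R_q,\omega,\lambda,\alpha_1,\alpha_2,\tau>0$ and $\phi,v\in\mathbb{R}$, let $\hat\Gamma\in\mathbb{R}^{d_1\times d_1}$ be symmetric and $\hat\Upsilon\in\mathbb{R}^{d_1\times d_2}$. Put $\mathbb{S}=\{\Theta\in\mathbb{R}^{d_1\times d_2}:\|\Theta\|_*\le\omega\}$, $\mathcal{L}(\Theta)=\frac12\langle\hat\Gamma\Theta,\Theta\rangle-\langle\hat\Upsilon,\Theta\rangle$ and $\Psi(\Theta)=\mathcal{L}(\Theta)+\lambda\|\Theta\|_*$. Let $\Theta^*\in\mathbb{S}$ satisfy $\sum_{j=1}^d\sigma_j(\Theta^*)^q\le R_q$ (with $0^0=0$, so that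 for $q=0$ the sum is the rank), and let $\hat\Theta$ be any global minimizer of $\Psi$ over $\mathbb{S}$. Suppose that (a) $\|\hat\Upsilon-\hat\Gamma\Theta^*\|_{\rm op}\le\phi\sqrt{\max(d_1,d_2)/n}$; (b) (RSC/RSM) $\alpha_1\|\Delta\|_F^2-\tau\|\Delta\|_*^2\le\langle\hat\Gamma\Delta,\Delta\rangle\le\alpha_2\|\Delta\|_F^2+\tau\|\Delta\|_*^2$ for all $\Delta\in\mathbb{R}^{d_1\times d_2}$, where $\tau\le\frac{\phi}{\omega}\sqrt{\max(d_1,d_2)/n}$; (c) $v\ge\max\{4\alpha_1,\alpha_2\}$ and $\lambda\ge\max\big\{(128\tau R_q/\alpha_1)^{1/q},\,4\phi\sqrt{\max(d_1,d_2)/n}\big\}$, where for $q=0$ the first bound is read as $128\tau R_0\le\alpha_1$. Define $$\bar\epsilon_{\rm stat}=8\lambda^{-q/2}R_q^{1/2}\big(\sqrt2\,\|\hat\Theta-\Theta^*\|_F+\lambda^{1-q/2}R_q^{1/2}\big),$$ $$\kappa=\Big\{1-\frac{\alpha_1}{8v}+\frac{256\tau\lambda^{-q}R_q}{\alpha_1}\Big\}\Big\{1-\frac{256\tau\lambda^{-q/2}R_q}{\alpha_1}\Big\}^{-1},\qquad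 \xi=\tau\Big\{\frac{\alpha_1}{8v}+\frac{512\tau\lambda^{q/2}R_q}{\alpha_1}+5\Big\}\Big\{1-\frac{256\tau\lambda^{-q/2}R_q}{\alpha_1}\Big\}^{-1},$$ and suppose that $\kappa\in(0,1)$. Let $\Theta^0\in\mathbb{S}$ and let $(\Theta^t)_{t\ge0}$ satisfy, for all $t\ge 0$, $$\Theta^{t+1}\in\arg\min_{\Theta\in\mathbb{S}}\Big\{\frac12\Big\|\Theta-\Big(\Theta^t-\frac{\hat\Gamma\Theta^t-\hat\Upsilon}{v}\Big)\Big\|_F^2+\frac{\lambda}{v}\|\Theta\|_*\Big\}.$$ Then for every $\delta^*\ge\frac{8\xi}{1-\kappa}\bar\epsilon_{\rm stat}^2$ and every integer $t\ge0$ with $t\ge T(\delta^*)$, $$\|\Theta^t-\hat\Theta\|_F^2\le\frac{4}{\alpha_1}\Big(\delta^*+\frac{{\delta^*}^2}{2\tau\omega^2}+2\tau\bar\epsilon_{\rm stat}^2\Big),$$ where $$T(\delta^*)=\log_2\log_2\Big(\frac{\omega\lambda}{\delta^*}\Big)\Big(1+\frac{\log2}{\log(1/\kappa)}\Big)+\frac{\log\big((\Psi(\Theta^0)-\Psi(\hat\Theta))/\delta^*\big)}{\log(1/\kappa)},$$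 in which the term $\log_2\log_2(\omega\lambda/\delta^*)$ is read as $0$ when $\omega\lambda/\delta^*<2$, and $T(\delta^*)$ is read as $0$ when $\Psi(\Theta^0)=\Psi(\hat\Theta)$. -/

import Mathlib

noncomputable section

namespace LowRankEIV

/-- The `j`-th largest singular value of a real `d₁ × d₂` matrix, counted from `j = 0`. -/
def singVal {d₁ d₂ : ℕ} (A : Matrix (Fin d₁) (Fin d₂) ℝ) (j : ℕ) : ℝ :=
  (Matrix.toEuclideanLin A).singularValues j

/-- The nuclear norm: the sum of the `min d₁ d₂` singular values. -/
def nucNorm {d₁ d₂ : ℕ} (A : Matrix (Fin d₁) (Fin d₂) ℝ) : ℝ :=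
  ∑ j ∈ Finset.range (min d₁ d₂), singVal A j

/-- The spectral norm: the operator norm of the matrix between Euclidean spaces. -/
def opNorm {d₁ d₂ : ℕ} (A : Matrix (Fin d₁) (Fin d₂) ℝ) : ℝ :=
  ‖(Matrix.toEuclideanLin A).toContinuousLinearMap‖

/-- The trace inner product `trace (Aᵀ B)`. -/
def trInner {d₁ d₂ : ℕ} (A B : Matrix (Fin d₁) (Fin d₂) ℝ) : ℝ :=
  (A.transpose * B).trace

/-- The Frobenius norm `√(trace (Aᵀ A))`. -/
def frobNorm {d₁ d₂ : ℕ} (A : Matrix (Fin d₁) (Fin d₂) ℝ) : ℝ :=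
  Real.sqrt (trInner A A)

/-- The matrix `ℓ_q`-ball of radius `R`, for `q ∈ [0, 1]`. Zero singular values contribute `0`,
also for `q = 0`, where the sum is the rank. -/
def lqBall (d₁ d₂ : ℕ) (q R : ℝ) : Set (Matrix (Fin d₁) (Fin d₂) ℝ) :=
  {A | ∑ j ∈ Finset.range (min d₁ d₂),
      (if singVal A j = 0 then 0 else |singVal A j| ^ q) ≤ R}

/-- The feasible region: the nuclear norm ball of radius `ω`. -/
def feasible (d₁ d₂ : ℕ) (ω : ℝ) : Set (Matrix (Fin d₁) (Fin d₂) ℝ) :=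
  {A | nucNorm A ≤ ω}

/-- The loss `½⟨Γ Θ, Θ⟩ - ⟨Υ, Θ⟩`. -/
def loss {d₁ d₂ : ℕ} (Γ : Matrix (Fin d₁) (Fin d₁) ℝ) (Υ Θ : Matrix (Fin d₁) (Fin d₂) ℝ) : ℝ :=
  1 / 2 * trInner (Γ * Θ) Θ - trInner Υ Θ

/-- The gradient of the loss (for symmetric `Γ`). -/
def gradLoss {d₁ d₂ : ℕ} (Γ : Matrix (Fin d₁) (Fin d₁) ℝ)
    (Υ Θ : Matrix (Fin d₁) (Fin d₂) ℝ) : Matrix (Fin d₁) (Fin d₂) ℝ :=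
  Γ * Θ - Υ

/-- The objective function: loss plus `lam` times the nuclear norm. -/
def objective {d₁ d₂ : ℕ} (Γ : Matrix (Fin d₁) (Fin d₁) ℝ) (Υ : Matrix (Fin d₁) (Fin d₂) ℝ)
    (lam : ℝ) (Θ : Matrix (Fin d₁) (Fin d₂) ℝ) : ℝ :=
  loss Γ Υ Θ + lam * nucNorm Θ

/-- `x` is a global minimizer of `f` over the set `S`. -/
def IsArgMin {d₁ d₂ : ℕ} (f : Matrix (Fin d₁) (Fin d₂) ℝ → ℝ)
    (S : Set (Matrix (Fin d₁) (Fin d₂) ℝ)) (x : Matrix (Fin d₁) (Fin d₂) ℝ) : Prop :=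
  x ∈ S ∧ ∀ y ∈ S, f x ≤ f y

/-- Restricted strong convexity of `Γ` with curvature `α₁` and tolerance `τ`. -/
def RSC {d₁ : ℕ} (d₂ : ℕ) (Γ : Matrix (Fin d₁) (Fin d₁) ℝ) (α₁ τ : ℝ) : Prop :=
  ∀ Δ : Matrix (Fin d₁) (Fin d₂) ℝ,
    α₁ * frobNorm Δ ^ 2 - τ * nucNorm Δ ^ 2 ≤ trInner (Γ * Δ) Δ

/-- Restricted strong smoothness of `Γ` with smoothness `α₂` and tolerance `τ`. -/
def RSM {d₁ : ℕ} (d₂ : ℕ) (Γ : Matrix (Fin d₁) (Fin d₁) ℝ) (α₂ τ : ℝ) : Prop :=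
  ∀ Δ : Matrix (Fin d₁) (Fin d₂) ℝ,
    trInner (Γ * Δ) Δ ≤ α₂ * frobNorm Δ ^ 2 + τ * nucNorm Δ ^ 2

/-- `Θ` is a sequence generated by the constrained proximal gradient method with step size `1 / v`
from a feasible initial point `Θ 0`. -/
def IsProxGradSeq {d₁ d₂ : ℕ} (Γ : Matrix (Fin d₁) (Fin d₁) ℝ) (Υ : Matrix (Fin d₁) (Fin d₂) ℝ)
    (lam ω v : ℝ) (Θ : ℕ → Matrix (Fin d₁) (Fin d₂) ℝ) : Prop :=
  Θ 0 ∈ feasible d₁ d₂ ω ∧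
    ∀ t, IsArgMin
      (fun A ↦ 1 / 2 * frobNorm (A - (Θ t - (1 / v) • gradLoss Γ Υ (Θ t))) ^ 2
        + lam / v * nucNorm A)
      (feasible d₁ d₂ ω) (Θ (t + 1))

/-- The quantity `ε̄_stat`. -/
def epsStat {d₁ d₂ : ℕ} (q R lam : ℝ) (Θhat Θstar : Matrix (Fin d₁) (Fin d₂) ℝ) : ℝ :=
  8 * lam ^ (-(q / 2)) * R ^ (1 / 2 : ℝ) *
    (Real.sqrt 2 * frobNorm (Θhat - Θstar) + lam ^ (1 - q / 2) * R ^ (1 / 2 : ℝ))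

/-- The contraction factor `κ`. -/
def kappa (α₁ τ v q R lam : ℝ) : ℝ :=
  (1 - α₁ / (8 * v) + 256 * τ * lam ^ (-q) * R / α₁) *
    (1 - 256 * τ * lam ^ (-(q / 2)) * R / α₁)⁻¹

/-- The quantity `ξ`. -/
def xi (α₁ τ v q R lam : ℝ) : ℝ :=
  τ * (α₁ / (8 * v) + 512 * τ * lam ^ (q / 2) * R / α₁ + 5) *
    (1 - 256 * τ * lam ^ (-(q / 2)) * R / α₁)⁻¹

open Classical in
/-- The iteration count `T(δ)`, where `gap` is the initial optimality gap. The inner `max` makes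
the iterated logarithm `log₂ log₂ (ω lam / δ)` equal to `0` when `ω lam / δ < 2`, and `gap = 0`
(where the formula gives `-∞`) means that no iteration is needed. -/
def iterCount (κ ω lam gap δ : ℝ) : ℝ :=
  if gap = 0 then 0 else
    Real.logb 2 (max 1 (Real.logb 2 (ω * lam / δ))) * (1 + Real.log 2 / Real.log (1 / κ))
      + Real.log (gap / δ) / Real.log (1 / κ)

end LowRankEIV

end

/-! Write g = α₁/v, s = λ^(-q) R and ε = ε̄_stat. The condition κ ∈ (0,1) is strong: it forces τs <
α₁/8192, κ ≥ 1 - g/8 and ξ ≥ 5τ (`kappa_bounds`), hence δ ≥ 1280 τε². One proximal step contracts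
the gap Ψ(Θ^t) - Ψ(Θ̂) up to an error caused by the tolerance τ (`prox_descent`). If every step
contracts by κ down to level δ, the last term of T(δ) alone makes the gap at most δ; the iterated
logarithm is slack. Three regimes of τ remain.

τ ≤ α₁/2: ⟨ΓΔ,Δ⟩ is a sum over columns, and on a single column the nuclear and Frobenius norms
agree, so RSC becomes ordinary strong convexity with constant α₁ - τ (`RSC.le_quad`) and the gap
contracts without error.

α₁/2 < τ ≤ 5v/8: now s < 1, so all singular values of Θ* are at most λ and ‖Θ*‖_* ≤ λs ≤ ε/8. No
low-rank decomposition is needed: the triangle inequality keeps near-minimizers close to Θ*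
(`nucNorm_sub_le_of_objective_sub_le`), and the RSC error is absorbed into the contraction.

τ > 5v/8: here λ ≥ 4τω outweighs the quadratic part of the step. Either δ is so large that the
diameter 2ω of the feasible set suffices, or a single step lands within 21‖Θ*‖_* of Θ*. -/

namespace LowRankEIV

open Matrix Module

/-! ### Singular bases, duality of norms, and matrices with one column. -/

section MatrixNorms

variable {d₁ d₂ : ℕ}

/-- The free choice of basis allows right singular vectors of either factor. -/
theorem trInner_eq_sum_inner {ι : Type*} [Fintype ι] (A B : Matrix (Fin d₁) (Fin d₂) ℝ)
    (b : OrthonormalBasis ι ℝ (EuclideanSpace ℝ (Fin d₂))) :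
    trInner A B = ∑ i, inner ℝ (toEuclideanLin A (b i)) (toEuclideanLin B (b i)) := by
  classical
  have h : (toEuclideanLin A).adjoint ∘ₗ toEuclideanLin B = toEuclideanLin (Aᵀ * B) := by
    rw [← toEuclideanLin_conjTranspose_eq_adjoint, conjTranspose_eq_transpose_of_trivial]
    ext x : 1
    simp [toLpLin_apply]
  have h2 : trInner A B = LinearMap.trace ℝ _ (toEuclideanLin (Aᵀ * B)) := by
    rw [toEuclideanLin_eq_toLin_orthonormal, LinearMap.trace_eq_matrix_trace ℝ
      (EuclideanSpace.basisFun (Fin d₂) ℝ).toBasis,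
      LinearMap.toMatrix_toLin, trInner]
  rw [h2, ← h, LinearMap.trace_eq_sum_inner _ b]
  simp [LinearMap.adjoint_inner_right]

/-- The trace inner product as a bilinear form. -/
def trForm (d₁ d₂ : ℕ) : LinearMap.BilinForm ℝ (Matrix (Fin d₁) (Fin d₂) ℝ) :=
  LinearMap.mk₂ ℝ trInner
    (fun A B C ↦ by simp [trInner, Matrix.add_mul])
    (fun c A B ↦ by simp [trInner])
    (fun A B C ↦ by simp [trInner, Matrix.mul_add])
    (fun c A B ↦ by simp [trInner])

@[simp]
theorem trForm_apply (A B : Matrix (Fin d₁) (Fin d₂) ℝ) : trForm d₁ d₂ A B = trInner A B := rfl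

theorem trInner_comm (A B : Matrix (Fin d₁) (Fin d₂) ℝ) : trInner A B = trInner B A := by
  rw [trInner, ← trace_transpose, transpose_mul, transpose_transpose, trInner]

theorem trInner_eq_sum_entries (A B : Matrix (Fin d₁) (Fin d₂) ℝ) :
    trInner A B = ∑ j, ∑ i, A i j * B i j := by
  simp [trInner, Matrix.trace, Matrix.mul_apply]

theorem trInner_self_nonneg (A : Matrix (Fin d₁) (Fin d₂) ℝ) : 0 ≤ trInner A A := by
  rw [trInner_eq_sum_entries]
  exact Finset.sum_nonneg fun _ _ ↦ Finset.sum_nonneg fun _ _ ↦ mul_self_nonneg _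

theorem frobNorm_sq (A : Matrix (Fin d₁) (Fin d₂) ℝ) : frobNorm A ^ 2 = trInner A A :=
  Real.sq_sqrt (trInner_self_nonneg A)

theorem frobNorm_nonneg (A : Matrix (Fin d₁) (Fin d₂) ℝ) : 0 ≤ frobNorm A := Real.sqrt_nonneg _

theorem singVal_nonneg (A : Matrix (Fin d₁) (Fin d₂) ℝ) (j : ℕ) : 0 ≤ singVal A j :=
  LinearMap.singularValues_nonneg _ j

theorem nucNorm_nonneg (A : Matrix (Fin d₁) (Fin d₂) ℝ) : 0 ≤ nucNorm A :=
  Finset.sum_nonneg fun _ _ ↦ singVal_nonneg A _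

theorem singVal_eq_zero_of_le (A : Matrix (Fin d₁) (Fin d₂) ℝ) {j : ℕ} (hj : min d₁ d₂ ≤ j) :
    singVal A j = 0 := by
  rw [singVal, LinearMap.singularValues_eq_zero_iff_le_finrank_range]
  refine le_trans (le_min ?_ ?_) hj
  · simpa using Submodule.finrank_le (toEuclideanLin A).range
  · simpa using LinearMap.finrank_range_le (toEuclideanLin A)

/-- Right singular vectors are indexed by `Fin d₂`; the singular values beyond `min d₁ d₂` vanish.
-/
theorem nucNorm_eq_sum_fin (A : Matrix (Fin d₁) (Fin d₂) ℝ) :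
    nucNorm A = ∑ i : Fin d₂, singVal A i := by
  rw [nucNorm, ← Finset.sum_range (fun i ↦ singVal A i)]
  refine Finset.sum_subset (Finset.range_mono (min_le_right _ _)) fun j _ hj ↦ ?_
  exact singVal_eq_zero_of_le A (not_lt.mp fun h ↦ hj (Finset.mem_range.mpr h))

/-- A right singular basis: `A` maps it to orthogonal vectors whose norms are the singular
values. -/
theorem exists_singular_basis (A : Matrix (Fin d₁) (Fin d₂) ℝ) :
    ∃ b : OrthonormalBasis (Fin d₂) ℝ (EuclideanSpace ℝ (Fin d₂)), ∀ i j,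
      inner ℝ (toEuclideanLin A (b i)) (toEuclideanLin A (b j))
        = if i = j then singVal A i ^ 2 else 0 := by
  have hn : finrank ℝ (EuclideanSpace ℝ (Fin d₂)) = d₂ := by simp
  have hT := (toEuclideanLin A).isSymmetric_adjoint_comp_self
  -- Eigenvectors of `AᵀA`, whose eigenvalues are the squared singular values.
  refine ⟨hT.eigenvectorBasis hn, fun i j ↦ ?_⟩
  have h := hT.apply_eigenvectorBasis hn j
  rw [LinearMap.comp_apply] at h
  rw [← LinearMap.adjoint_inner_right, h, inner_smul_right,
    orthonormal_iff_ite.mp (hT.eigenvectorBasis hn).orthonormal i j,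
    ← LinearMap.sq_singularValues_fin]
  split_ifs with hij
  · subst hij; simp [singVal]
  · simp

theorem norm_toEuclideanLin_le (A : Matrix (Fin d₁) (Fin d₂) ℝ)
    (x : EuclideanSpace ℝ (Fin d₂)) : ‖toEuclideanLin A x‖ ≤ opNorm A * ‖x‖ :=
  (toEuclideanLin A).toContinuousLinearMap.le_opNorm x

/-- Duality of the spectral and the nuclear norm. -/
theorem trInner_le_opNorm_mul_nucNorm (A B : Matrix (Fin d₁) (Fin d₂) ℝ) :
    trInner A B ≤ opNorm A * nucNorm B := by
  obtain ⟨b, hb⟩ := exists_singular_basis B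
  rw [trInner_eq_sum_inner A B b, nucNorm_eq_sum_fin, Finset.mul_sum]
  refine Finset.sum_le_sum fun i _ ↦ (real_inner_le_norm _ _).trans ?_
  have h1 : ‖toEuclideanLin B (b i)‖ = singVal B i := by
    rw [norm_eq_sqrt_real_inner, hb, if_pos rfl, Real.sqrt_sq (singVal_nonneg B i)]
  have h2 := norm_toEuclideanLin_le A (b i)
  rw [b.norm_eq_one, mul_one] at h2
  rw [h1]
  exact mul_le_mul_of_nonneg_right h2 (singVal_nonneg B i)

/-- The nuclear norm is attained by the trace inner product with a matrix of spectral norm at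
most one. -/
theorem exists_dual_certificate (B : Matrix (Fin d₁) (Fin d₂) ℝ) :
    ∃ A : Matrix (Fin d₁) (Fin d₂) ℝ, opNorm A ≤ 1 ∧ trInner A B = nucNorm B := by
  obtain ⟨b, hb⟩ := exists_singular_basis B
  -- The partial isometry of the polar decomposition; the convention `0⁻¹ = 0` makes it vanish on
  -- the kernel of `B`.
  let L : EuclideanSpace ℝ (Fin d₂) →ₗ[ℝ] EuclideanSpace ℝ (Fin d₁) :=
    b.toBasis.constr ℝ fun i ↦ (singVal B i)⁻¹ • toEuclideanLin B (b i)
  have hL : ∀ i, L (b i) = (singVal B i)⁻¹ • toEuclideanLin B (b i) := fun i ↦ by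
    simp [L]
  have hLL : ∀ i j, inner ℝ (L (b i)) (L (b j))
      = if i = j then ((singVal B i)⁻¹ * singVal B i) ^ 2 else 0 := fun i j ↦ by
    rw [hL, hL, inner_smul_left, inner_smul_right, hb]
    split_ifs with h
    · subst h; simp; ring
    · simp
  refine ⟨toEuclideanLin.symm L, ?_, ?_⟩
  · refine ContinuousLinearMap.opNorm_le_bound _ zero_le_one fun x ↦ ?_
    rw [LinearEquiv.apply_symm_apply, one_mul]
    change ‖L x‖ ≤ ‖x‖
    refine le_of_sq_le_sq ?_ (norm_nonneg x)
    have hx : L x = ∑ i, b.repr x i • L (b i) := by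
      conv_lhs => rw [← b.sum_repr x]
      simp
    rw [← real_inner_self_eq_norm_sq, hx, ← b.sum_sq_norm_inner_right x, sum_inner]
    refine Finset.sum_le_sum fun i _ ↦ ?_
    simp only [inner_sum, inner_smul_left, inner_smul_right, hLL, b.repr_apply_apply]
    simp only [mul_ite, mul_zero, Finset.sum_ite_eq, Finset.mem_univ, if_true,
      Real.norm_eq_abs, sq_abs]
    by_cases h0 : singVal B i = 0
    · simp [h0, sq_nonneg]
    · simp [h0, sq]
  · rw [trInner_eq_sum_inner _ B b, nucNorm_eq_sum_fin]
    refine Finset.sum_congr rfl fun i _ ↦ ?_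
    rw [LinearEquiv.apply_symm_apply, hL, inner_smul_left, hb, if_pos rfl]
    by_cases h0 : singVal B i = 0
    · simp [h0]
    · simp [sq, h0]

theorem trInner_le_nucNorm {A : Matrix (Fin d₁) (Fin d₂) ℝ} (hA : opNorm A ≤ 1)
    (B : Matrix (Fin d₁) (Fin d₂) ℝ) : trInner A B ≤ nucNorm B :=
  (trInner_le_opNorm_mul_nucNorm A B).trans
    (mul_le_of_le_one_left (nucNorm_nonneg B) hA)

/-- By duality the nuclear norm is a maximum of linear functionals. -/
theorem nucNorm_add_le (A B : Matrix (Fin d₁) (Fin d₂) ℝ) :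
    nucNorm (A + B) ≤ nucNorm A + nucNorm B := by
  obtain ⟨C, hC, h⟩ := exists_dual_certificate (A + B)
  rw [← h, ← trForm_apply, map_add]
  exact add_le_add (trInner_le_nucNorm hC A) (trInner_le_nucNorm hC B)

theorem opNorm_neg (A : Matrix (Fin d₁) (Fin d₂) ℝ) : opNorm (-A) = opNorm A := by
  simp [opNorm]

theorem nucNorm_smul_le (c : ℝ) (A : Matrix (Fin d₁) (Fin d₂) ℝ) :
    nucNorm (c • A) ≤ |c| * nucNorm A := by
  obtain ⟨C, hC, h⟩ := exists_dual_certificate (c • A)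
  rw [← h, ← trForm_apply, map_smul, smul_eq_mul]
  have h1 := trInner_le_nucNorm hC A
  have h2 := trInner_le_nucNorm (A := -C) (by rwa [opNorm_neg]) A
  rw [← trForm_apply, map_neg, LinearMap.neg_apply] at h2
  rw [← trForm_apply] at h1
  refine (le_abs_self _).trans ?_
  rw [abs_mul]
  exact mul_le_mul_of_nonneg_left (abs_le.mpr ⟨by linarith, h1⟩) (abs_nonneg c)

theorem norm_toEuclideanLin_le_frobNorm (A : Matrix (Fin d₁) (Fin d₂) ℝ)
    (x : EuclideanSpace ℝ (Fin d₂)) : ‖toEuclideanLin A x‖ ≤ frobNorm A * ‖x‖ := by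
  refine le_of_sq_le_sq ?_ (mul_nonneg (frobNorm_nonneg A) (norm_nonneg x))
  rw [mul_pow, frobNorm_sq, trInner_eq_sum_entries, EuclideanSpace.norm_sq_eq,
    EuclideanSpace.norm_sq_eq, Finset.sum_comm, Finset.sum_mul]
  refine Finset.sum_le_sum fun i _ ↦ ?_
  simp only [toLpLin_apply, mulVec, dotProduct, Real.norm_eq_abs, sq_abs, ← sq]
  exact Finset.sum_mul_sq_le_sq_mul_sq _ _ _

theorem opNorm_le_frobNorm (A : Matrix (Fin d₁) (Fin d₂) ℝ) : opNorm A ≤ frobNorm A :=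
  ContinuousLinearMap.opNorm_le_bound _ (frobNorm_nonneg A) (norm_toEuclideanLin_le_frobNorm A)

/-- ‖A‖_F² ≤ ‖A‖_op ‖A‖_* ≤ ‖A‖_F ‖A‖_*. -/
theorem frobNorm_le_nucNorm (A : Matrix (Fin d₁) (Fin d₂) ℝ) : frobNorm A ≤ nucNorm A := by
  rcases (frobNorm_nonneg A).eq_or_lt with h | h
  · rw [← h]; exact nucNorm_nonneg A
  · have h1 := trInner_le_opNorm_mul_nucNorm A A
    rw [← frobNorm_sq] at h1
    have h2 := mul_le_mul_of_nonneg_right (opNorm_le_frobNorm A) (nucNorm_nonneg A)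
    nlinarith

/-- A matrix with a single nonzero column. -/
def singleCol (j : Fin d₂) (u : Fin d₁ → ℝ) : Matrix (Fin d₁) (Fin d₂) ℝ :=
  vecMulVec u (Pi.single j 1)

theorem trInner_singleCol (j : Fin d₂) (u : Fin d₁ → ℝ) (A : Matrix (Fin d₁) (Fin d₂) ℝ) :
    trInner A (singleCol j u) = ∑ i, A i j * u i := by
  rw [trInner_eq_sum_entries, Finset.sum_eq_single j]
  · simp [singleCol, vecMulVec_apply]
  · intro k _ hk
    simp [singleCol, vecMulVec_apply, hk]
  · simp

theorem frobNorm_singleCol_sq (j : Fin d₂) (u : Fin d₁ → ℝ) :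
    frobNorm (singleCol j u) ^ 2 = ∑ i, u i * u i := by
  rw [frobNorm_sq, trInner_singleCol]
  simp [singleCol, vecMulVec_apply]

/-- The rank is at most one. These are the test matrices that turn restricted curvature into full
curvature. -/
theorem nucNorm_singleCol_le (j : Fin d₂) (u : Fin d₁ → ℝ) :
    nucNorm (singleCol j u) ≤ frobNorm (singleCol j u) := by
  obtain ⟨C, hC, h⟩ := exists_dual_certificate (singleCol j u)
  rw [← h, trInner_singleCol]
  have h1 := norm_toEuclideanLin_le C (EuclideanSpace.single j 1)
  have h2 : ∑ i, C i j * u i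
      = inner ℝ (WithLp.toLp 2 u) (toEuclideanLin C (EuclideanSpace.single j 1)) := by
    simp [toLpLin_apply, PiLp.inner_apply]
  have h3 : frobNorm (singleCol j u) = ‖WithLp.toLp 2 u‖ := by
    rw [← Real.sqrt_sq (frobNorm_nonneg _), frobNorm_singleCol_sq, EuclideanSpace.norm_eq]
    simp [sq]
  rw [h2, h3]
  refine (real_inner_le_norm _ _).trans (mul_le_of_le_one_right (norm_nonneg _) ?_)
  refine h1.trans ?_
  simpa using hC

end MatrixNorms

/-! ### Optimality and descent for a quadratic plus a convex function. -/

section Abstract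

variable {E : Type*} [AddCommGroup E] [Module ℝ E]

/-- First-order optimality for a quadratic plus a convex function over a convex set. -/
theorem variational_inequality (H : LinearMap.BilinForm ℝ E) (hH : ∀ x y, H x y = H y x)
    (w : E →ₗ[ℝ] ℝ) {N : E → ℝ} {μ : ℝ} (hμ : 0 ≤ μ) {S : Set E} (hN : ConvexOn ℝ S N)
    {x : E} (hx : x ∈ S)
    (hmin : ∀ y ∈ S, 1 / 2 * H x x - w x + μ * N x ≤ 1 / 2 * H y y - w y + μ * N y)
    {y : E} (hy : y ∈ S) : 0 ≤ H x (y - x) - w (y - x) + μ * (N y - N x) := by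
  set c := H x (y - x) - w (y - x) + μ * (N y - N x)
  set h := H (y - x) (y - x)
  -- Compare `x` with `x + t(y - x)` and divide by `t`. As `H` may be indefinite, the second-order
  -- term is kept.
  have key : ∀ t : ℝ, 0 < t → t ≤ 1 → 0 ≤ c + t / 2 * h := by
    intro t ht ht1
    have hmem : (1 - t) • x + t • y ∈ S := hN.1 hx hy (by linarith) ht.le (by ring)
    have hconv := hN.2 hx hy (by linarith : 0 ≤ 1 - t) ht.le (by ring)
    have h1 := hmin _ hmem
    have h2 := mul_le_mul_of_nonneg_left hconv hμ
    simp only [smul_eq_mul] at h2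
    have e : (1 - t) • x + t • y = x + t • (y - x) := by module
    rw [e] at h1 h2
    have h3 : H (x + t • (y - x)) (x + t • (y - x)) = H x x + 2 * t * H x (y - x) + t ^ 2 * h := by
      simp only [map_add, LinearMap.add_apply, map_smul, LinearMap.smul_apply, smul_eq_mul,
        hH (y - x) x, h]
      ring
    have h4 : w (x + t • (y - x)) = w x + t * w (y - x) := by
      simp only [map_add, map_smul, smul_eq_mul]
    rw [h3, h4] at h1
    have h5 : 0 ≤ t * (c + t / 2 * h) := by
      simp only [c]
      nlinarith
    exact nonneg_of_mul_nonneg_right h5 ht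
  by_contra! hc
  rcases le_or_gt h 0 with h0 | h0
  · have := key 1 one_pos le_rfl
    linarith
  -- For this `t` one has `t * h ≤ -c`, so `key` would give `0 ≤ c / 2`.
  · have h1 := key (min 1 (-c / h)) (lt_min one_pos (div_pos (by linarith) h0)) (min_le_left _ _)
    have h2 : min 1 (-c / h) * h ≤ -c := by
      calc _ ≤ (-c / h) * h := mul_le_mul_of_nonneg_right (min_le_right _ _) h0.le
        _ = -c := by field_simp
    linarith

/-- One step of the proximal gradient method with step size `1 / v`: contraction of the optimality
gap up to an error coming from restricted strong convexity. -/
theorem prox_descent (F Q : LinearMap.BilinForm ℝ E) (hF : ∀ x y, F x y = F y x)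
    (hF0 : ∀ x, 0 ≤ F x x) (hQ : ∀ x y, Q x y = Q y x) (u : E →ₗ[ℝ] ℝ) {N Ψ : E → ℝ}
    {v τ α γ e lam : ℝ} (hΨ : ∀ a, Ψ a = 1 / 2 * Q a a - u a + lam * N a) {x p z : E}
    (hx : 0 ≤ v * F (p - x) (x - p) + (Q x (x - p) - u (x - p)) + lam * (N x - N p))
    (hz : 0 ≤ v * F (p - x) (z - p) + (Q x (z - p) - u (z - p)) + lam * (N z - N p))
    (hup : Q (p - x) (p - x) ≤ (v + τ) * F (p - x) (p - x))
    (hlow : α * F (z - x) (z - x) - e ≤ Q (z - x) (z - x))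
    (hτ : τ < v) (hγ0 : 0 ≤ γ) (hγ1 : γ ≤ 1) (hγ : γ * v ^ 2 ≤ (v - τ) * α) :
    Ψ p - Ψ z ≤ (1 - γ) * (Ψ x - Ψ z) + γ / 2 * e := by
  obtain ⟨P, rfl⟩ : ∃ P, p = x + P := ⟨p - x, by abel⟩
  obtain ⟨D, rfl⟩ : ∃ D, z = x + D := ⟨z - x, by abel⟩
  have e1 : x - (x + P) = -P := by abel
  have e2 : x + D - (x + P) = D - P := by abel
  rw [e1] at hx
  rw [e2] at hz
  rw [add_sub_cancel_left] at hx hz hup hlow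
  rw [hΨ, hΨ, hΨ]
  simp only [map_add, map_sub, map_neg, LinearMap.add_apply] at hx hz ⊢
  have hw : 0 < v - τ := by linarith
  -- Completing the square: `hγ` bounds γ²v² by γ(v - τ)α, which absorbs the cross term of `P` and
  -- `D`.
  have hsq := hF0 ((v - τ) • P - (γ * v) • D)
  simp only [map_sub, map_smul, LinearMap.sub_apply, LinearMap.smul_apply, smul_eq_mul,
    hF D P] at hsq
  have hcross : 0 ≤ (v - τ) / 2 * F P P - γ * v * F P D + γ * α / 2 * F D D := by
    refine nonneg_of_mul_nonneg_right (a := 2 * (v - τ)) ?_ (by linarith)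
    have := mul_le_mul_of_nonneg_left hγ (mul_nonneg hγ0 (hF0 D))
    nlinarith
  rw [hQ P x, hQ D x]
  -- The optimality inequalities tested at `x` and at `z` are averaged with weights 1 - γ and γ.
  have hx' := mul_le_mul_of_nonneg_left hx (by linarith : 0 ≤ 1 - γ)
  have hz' := mul_le_mul_of_nonneg_left hz hγ0
  have hl' := mul_le_mul_of_nonneg_left hlow hγ0
  linarith

/-- A symmetric form whose quadratic form is dominated by `c F` is dominated by `c` times the
product of the lengths. -/
theorem form_le_of_abs_quad_le (F B : LinearMap.BilinForm ℝ E) (hF : ∀ x y, F x y = F y x)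
    (hB : ∀ x y, B x y = B y x) {c : ℝ} (hc : 0 ≤ c) (hBF : ∀ z, |B z z| ≤ c * F z z)
    {x y : E} {M m : ℝ} (hM : 0 < M) (hm : 0 < m) (hx : F x x ≤ M ^ 2) (hy : F y y ≤ m ^ 2) :
    B x y ≤ c * M * m := by
  -- Polarization, after rescaling both vectors to the same length bound; `B` may be indefinite, so
  -- it has no Cauchy-Schwarz inequality of its own.
  have h1 := (abs_le.mp (hBF (m • x + M • y))).2
  have h2 := (abs_le.mp (hBF (m • x - M • y))).1
  simp only [map_add, map_sub, map_smul, LinearMap.add_apply, LinearMap.sub_apply,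
    LinearMap.smul_apply, smul_eq_mul, hB y x, hF y x] at h1 h2
  have h3 := mul_le_mul_of_nonneg_left hx (mul_nonneg hc (sq_nonneg m))
  have h4 := mul_le_mul_of_nonneg_left hy (mul_nonneg hc (sq_nonneg M))
  refine le_of_mul_le_mul_left ?_ (mul_pos hM hm)
  nlinarith

end Abstract

/-! ### The quadratic form of Γ, and variational inequalities for minimizers and iterates. -/

section Forms

variable {d₁ d₂ : ℕ}

/-- Γ acts on each column separately. Apply `h` to the columns one by one, where the two norms
agree, and add up. -/
theorem quad_le_of_nuc {Γ : Matrix (Fin d₁) (Fin d₁) ℝ} {a b : ℝ} (hb : 0 ≤ b)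
    (h : ∀ Δ : Matrix (Fin d₁) (Fin d₂) ℝ,
      trInner (Γ * Δ) Δ ≤ a * frobNorm Δ ^ 2 + b * nucNorm Δ ^ 2)
    (Δ : Matrix (Fin d₁) (Fin d₂) ℝ) : trInner (Γ * Δ) Δ ≤ (a + b) * frobNorm Δ ^ 2 := by
  have hcol : ∀ j : Fin d₂, ∑ i, (Γ * Δ) i j * Δ i j ≤ (a + b) * ∑ i, Δ i j * Δ i j := by
    intro j
    have h1 := h (singleCol j fun i ↦ Δ i j)
    have h2 := pow_le_pow_left₀ (nucNorm_nonneg _) (nucNorm_singleCol_le j fun i ↦ Δ i j) 2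
    have h3 := mul_le_mul_of_nonneg_left h2 hb
    have h4 : trInner (Γ * singleCol j fun i ↦ Δ i j) (singleCol j fun i ↦ Δ i j)
        = ∑ i, (Γ * Δ) i j * Δ i j := by
      rw [trInner_singleCol]
      simp [Matrix.mul_apply, singleCol, vecMulVec_apply]
    rw [h4] at h1
    rw [← frobNorm_singleCol_sq]
    linarith
  rw [frobNorm_sq, trInner_eq_sum_entries, trInner_eq_sum_entries, Finset.mul_sum]
  exact Finset.sum_le_sum fun j _ ↦ hcol j

theorem RSM.quad_le {Γ : Matrix (Fin d₁) (Fin d₁) ℝ} {α₂ τ : ℝ} (hτ : 0 ≤ τ)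
    (h : RSM d₂ Γ α₂ τ) (Δ : Matrix (Fin d₁) (Fin d₂) ℝ) :
    trInner (Γ * Δ) Δ ≤ (α₂ + τ) * frobNorm Δ ^ 2 :=
  quad_le_of_nuc hτ h Δ

theorem RSC.le_quad {Γ : Matrix (Fin d₁) (Fin d₁) ℝ} {α₁ τ : ℝ} (hτ : 0 ≤ τ)
    (h : RSC d₂ Γ α₁ τ) (Δ : Matrix (Fin d₁) (Fin d₂) ℝ) :
    (α₁ - τ) * frobNorm Δ ^ 2 ≤ trInner (Γ * Δ) Δ := by
  have hneg : ∀ Δ : Matrix (Fin d₁) (Fin d₂) ℝ, trInner (-Γ * Δ) Δ = -trInner (Γ * Δ) Δ :=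
    fun Δ ↦ by simp [trInner]
  have := quad_le_of_nuc (Γ := -Γ) (a := -α₁) hτ (fun Δ ↦ by rw [hneg]; linarith [h Δ]) Δ
  rw [hneg] at this
  linarith

/-- The bilinear form `⟨Γ A, B⟩`. -/
def gramForm (d₂ : ℕ) (Γ : Matrix (Fin d₁) (Fin d₁) ℝ) :
    LinearMap.BilinForm ℝ (Matrix (Fin d₁) (Fin d₂) ℝ) :=
  LinearMap.mk₂ ℝ (fun A B ↦ trInner (Γ * A) B)
    (fun A B C ↦ by simp [trInner, Matrix.mul_add, Matrix.add_mul])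
    (fun c A B ↦ by simp [trInner])
    (fun A B C ↦ by simp [trInner, Matrix.mul_add])
    (fun c A B ↦ by simp [trInner])

@[simp]
theorem gramForm_apply (Γ : Matrix (Fin d₁) (Fin d₁) ℝ) (A B : Matrix (Fin d₁) (Fin d₂) ℝ) :
    gramForm d₂ Γ A B = trInner (Γ * A) B := rfl

theorem gramForm_comm {Γ : Matrix (Fin d₁) (Fin d₁) ℝ} (hΓ : Γ.IsSymm)
    (A B : Matrix (Fin d₁) (Fin d₂) ℝ) : gramForm d₂ Γ A B = gramForm d₂ Γ B A := by
  rw [gramForm_apply, gramForm_apply, trInner_comm, trInner, trInner, transpose_mul, hΓ.eq,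
    Matrix.mul_assoc]

theorem nucNorm_neg (A : Matrix (Fin d₁) (Fin d₂) ℝ) : nucNorm (-A) = nucNorm A := by
  have h : ∀ B : Matrix (Fin d₁) (Fin d₂) ℝ, nucNorm (-B) ≤ nucNorm B := fun B ↦ by
    simpa using nucNorm_smul_le (-1) B
  exact le_antisymm (h A) (by simpa using h (-A))

theorem nucNorm_sub_le (A B : Matrix (Fin d₁) (Fin d₂) ℝ) :
    nucNorm (A - B) ≤ nucNorm A + nucNorm B := by
  rw [sub_eq_add_neg, ← nucNorm_neg B]
  exact nucNorm_add_le A (-B)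

theorem convexOn_nucNorm (S : Set (Matrix (Fin d₁) (Fin d₂) ℝ)) (hS : Convex ℝ S) :
    ConvexOn ℝ S nucNorm := by
  refine ⟨hS, fun A _ B _ a b ha hb _ ↦ ?_⟩
  refine (nucNorm_add_le _ _).trans (add_le_add ?_ ?_)
  · simpa [abs_of_nonneg ha] using nucNorm_smul_le a A
  · simpa [abs_of_nonneg hb] using nucNorm_smul_le b B

theorem convex_feasible (ω : ℝ) : Convex ℝ (feasible d₁ d₂ ω) := by
  have := (convexOn_nucNorm (d₁ := d₁) (d₂ := d₂) Set.univ convex_univ).convex_le ω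
  simpa [feasible] using this

theorem objective_eq (Γ : Matrix (Fin d₁) (Fin d₁) ℝ) (Υ : Matrix (Fin d₁) (Fin d₂) ℝ) (lam : ℝ)
    (A : Matrix (Fin d₁) (Fin d₂) ℝ) :
    objective Γ Υ lam A = 1 / 2 * gramForm d₂ Γ A A - trForm d₁ d₂ Υ A + lam * nucNorm A := rfl

theorem IsArgMin.objective_vi {Γ : Matrix (Fin d₁) (Fin d₁) ℝ} (hΓ : Γ.IsSymm)
    {Υ : Matrix (Fin d₁) (Fin d₂) ℝ} {lam ω : ℝ} (hlam : 0 ≤ lam)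
    {X : Matrix (Fin d₁) (Fin d₂) ℝ} (hX : IsArgMin (objective Γ Υ lam) (feasible d₁ d₂ ω) X)
    {A : Matrix (Fin d₁) (Fin d₂) ℝ} (hA : A ∈ feasible d₁ d₂ ω) :
    0 ≤ gramForm d₂ Γ X (A - X) - trForm d₁ d₂ Υ (A - X) + lam * (nucNorm A - nucNorm X) :=
  variational_inequality (gramForm d₂ Γ) (gramForm_comm hΓ) (trForm d₁ d₂ Υ) hlam
    (convexOn_nucNorm _ (convex_feasible ω)) hX.1 hX.2 hA

theorem IsProxGradSeq.mem {Γ : Matrix (Fin d₁) (Fin d₁) ℝ} {Υ : Matrix (Fin d₁) (Fin d₂) ℝ}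
    {lam ω v : ℝ} {Θ : ℕ → Matrix (Fin d₁) (Fin d₂) ℝ} (hΘ : IsProxGradSeq Γ Υ lam ω v Θ) (t : ℕ) :
    Θ t ∈ feasible d₁ d₂ ω := by
  cases t with
  | zero => exact hΘ.1
  | succ t => exact (hΘ.2 t).1

theorem IsProxGradSeq.vi {Γ : Matrix (Fin d₁) (Fin d₁) ℝ} {Υ : Matrix (Fin d₁) (Fin d₂) ℝ}
    {lam ω v : ℝ} (hlam : 0 ≤ lam) (hv : 0 < v)
    {Θ : ℕ → Matrix (Fin d₁) (Fin d₂) ℝ} (hΘ : IsProxGradSeq Γ Υ lam ω v Θ) (t : ℕ)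
    {A : Matrix (Fin d₁) (Fin d₂) ℝ} (hA : A ∈ feasible d₁ d₂ ω) :
    0 ≤ v * trForm d₁ d₂ (Θ (t + 1) - Θ t) (A - Θ (t + 1))
      + (gramForm d₂ Γ (Θ t) (A - Θ (t + 1)) - trForm d₁ d₂ Υ (A - Θ (t + 1)))
      + lam * (nucNorm A - nucNorm (Θ (t + 1))) := by
  obtain ⟨hmem, hmin⟩ := hΘ.2 t
  set Z := Θ t - (1 / v) • gradLoss Γ Υ (Θ t) with hZ
  have hexp : ∀ B : Matrix (Fin d₁) (Fin d₂) ℝ, frobNorm (B - Z) ^ 2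
      = trForm d₁ d₂ B B - 2 * trForm d₁ d₂ Z B + trForm d₁ d₂ Z Z := fun B ↦ by
    rw [frobNorm_sq, ← trForm_apply]
    simp only [map_sub, LinearMap.sub_apply]
    rw [trForm_apply B Z, trInner_comm B Z, ← trForm_apply]
    ring
  have h := variational_inequality (trForm d₁ d₂) (fun A B ↦ trInner_comm A B) (trForm d₁ d₂ Z)
    (div_nonneg hlam hv.le) (convexOn_nucNorm _ (convex_feasible ω)) hmem (fun B hB ↦ by
      have := hmin B hB
      simp only [hexp] at this
      linarith) hA
  have hZA : trForm d₁ d₂ Z (A - Θ (t + 1)) = trForm d₁ d₂ (Θ t) (A - Θ (t + 1))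
      - 1 / v * (gramForm d₂ Γ (Θ t) (A - Θ (t + 1)) - trForm d₁ d₂ Υ (A - Θ (t + 1))) := by
    rw [hZ, gradLoss, gramForm_apply, ← trForm_apply (Γ * Θ t)]
    simp only [map_sub, map_smul, LinearMap.sub_apply, LinearMap.smul_apply, smul_eq_mul]
    ring
  rw [hZA] at h
  rw [map_sub (trForm d₁ d₂) (Θ (t + 1)), LinearMap.sub_apply]
  have h2 := mul_nonneg hv.le h
  field_simp at h2
  linarith

end Forms

/-! ### Consequences of the constants, and scalar recursions. -/

section Scalars

variable {α₁ τ v q R lam : ℝ}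

/-- Write κ = (1 - g + x)/(1 - y), with `g`, `x`, `y` as in the proof. Then κ < 1 gives x + y < g ≤
1/32, and the inverse of the denominator is at least 1. -/
theorem kappa_bounds (hα₁ : 0 < α₁) (hτ : 0 < τ) (hv : 4 * α₁ ≤ v) (hR : 0 < R) (hlam : 0 < lam)
    (hκ : kappa α₁ τ v q R lam ∈ Set.Ioo (0 : ℝ) 1) :
    τ * (lam ^ (-q) * R) < α₁ / 8192 ∧ 1 - α₁ / (8 * v) ≤ kappa α₁ τ v q R lam ∧
      5 * τ ≤ xi α₁ τ v q R lam := by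
  have hv0 : 0 < v := by linarith
  have hg0 : 0 < α₁ / (8 * v) := by positivity
  have hg1 : α₁ / (8 * v) ≤ 1 / 32 := by
    rw [div_le_div_iff₀ (by positivity) (by norm_num)]
    linarith
  have hx : 0 < 256 * τ * lam ^ (-q) * R / α₁ := by positivity
  have hy : 0 < 256 * τ * lam ^ (-(q / 2)) * R / α₁ := by positivity
  have hz : 0 < 512 * τ * lam ^ (q / 2) * R / α₁ := by positivity
  have hxe : 256 * τ * lam ^ (-q) * R / α₁ * α₁ = 256 * (τ * (lam ^ (-q) * R)) := by
    field_simp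
  unfold kappa at hκ ⊢
  unfold xi
  set g := α₁ / (8 * v)
  set x := 256 * τ * lam ^ (-q) * R / α₁
  set y := 256 * τ * lam ^ (-(q / 2)) * R / α₁
  set z := 512 * τ * lam ^ (q / 2) * R / α₁
  -- The numerator of κ is positive, so κ > 0 forces a positive denominator.
  have hy1 : 0 < 1 - y := inv_pos.mp (pos_of_mul_pos_right hκ.1 (by linarith))
  have hinv : 1 ≤ (1 - y)⁻¹ := (one_le_inv₀ hy1).mpr (by linarith)
  have hlt : 1 - g + x < 1 - y := by
    have := hκ.2
    rwa [← div_eq_mul_inv, div_lt_one hy1] at this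
  refine ⟨?_, ?_, ?_⟩
  · have : x * α₁ < 1 / 32 * α₁ := mul_lt_mul_of_pos_right (by linarith) hα₁
    linarith
  · calc 1 - g ≤ 1 - g + x := by linarith
      _ ≤ _ := le_mul_of_one_le_right (by linarith) hinv
  · calc 5 * τ ≤ τ * (g + z + 5) := by nlinarith
      _ ≤ _ := le_mul_of_one_le_right (by positivity) hinv

/-- The iterated logarithm contributes a nonnegative amount and is dropped. -/
theorem le_of_iterCount_le {κ ω lam gap δ : ℝ} {t : ℕ} (hκ : κ ∈ Set.Ioo (0 : ℝ) 1)
    (hgap : 0 ≤ gap) (hδ : 0 < δ) (ht : iterCount κ ω lam gap δ ≤ t) : κ ^ t * gap ≤ δ := by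
  rcases hgap.eq_or_lt with h0 | h0
  · rw [← h0, mul_zero]
    exact hδ.le
  rw [iterCount, if_neg h0.ne'] at ht
  have hlog : 0 < Real.log (1 / κ) := Real.log_pos (by rw [lt_div_iff₀ hκ.1]; linarith [hκ.2])
  have h1 : 0 ≤ Real.logb 2 (max 1 (Real.logb 2 (ω * lam / δ))) *
      (1 + Real.log 2 / Real.log (1 / κ)) := by
    refine mul_nonneg (Real.logb_nonneg one_lt_two (le_max_left _ _)) ?_
    have := Real.log_pos one_lt_two
    positivity
  have h2 : Real.log (gap / δ) ≤ t * Real.log (1 / κ) := by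
    rw [← div_le_iff₀ hlog]
    linarith
  rw [← Real.log_pow, Real.log_le_log_iff (by positivity) (pow_pos (one_div_pos.mpr hκ.1) _),
    div_le_iff₀ hδ, one_div, inv_pow] at h2
  have hp := pow_pos hκ.1 t
  calc κ ^ t * gap ≤ κ ^ t * ((κ ^ t)⁻¹ * δ) := mul_le_mul_of_nonneg_left h2 hp.le
    _ = δ := by field_simp

theorem le_max_of_contraction {κ δ : ℝ} (hκ0 : 0 ≤ κ) (hκ1 : κ ≤ 1) (hδ : 0 ≤ δ) {η : ℕ → ℝ}
    (h : ∀ t, η (t + 1) ≤ κ * max (η t) δ) (t : ℕ) : η t ≤ max (κ ^ t * η 0) δ := by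
  induction t with
  | zero => simp
  | succ t ih =>
    refine (h t).trans ?_
    have h1 : max (η t) δ ≤ max (κ ^ t * η 0) δ := max_le ih (le_max_right _ _)
    refine (mul_le_mul_of_nonneg_left h1 hκ0).trans ?_
    rw [mul_max_of_nonneg _ _ hκ0]
    refine max_le_max (by rw [pow_succ']; linarith) (mul_le_of_le_one_left hδ hκ1)

/-- With a = min(2η/λ, 2ω), a² ≤ (2ω)(2η/λ) and 4τω ≤ λ give τa² ≤ η. The weighted bound (a + ε)² ≤
(9/8)a² + 9ε² keeps the factor of η close to 1, which the contraction needs. -/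
theorem mul_sq_le_of_le_add {τ ω lam η ε D : ℝ} (hlam : 0 < lam) (hτ : 0 ≤ τ) (hω : 0 ≤ ω)
    (hτω : 4 * (τ * ω) ≤ lam) (hη : 0 ≤ η) (hε : 0 ≤ ε) (hD : 0 ≤ D)
    (h1 : D ≤ 2 * η / lam + ε) (h2 : D ≤ 2 * ω) : τ * D ^ 2 ≤ 9 / 8 * η + 9 * (τ * ε ^ 2) := by
  obtain ⟨a, ha0, ha1, ha2, ha3⟩ : ∃ a, 0 ≤ a ∧ a ≤ 2 * ω ∧ a * lam ≤ 2 * η ∧ D ≤ a + ε := by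
    refine ⟨min (2 * η / lam) (2 * ω), by positivity, min_le_right _ _, ?_, ?_⟩
    · rw [← le_div_iff₀ hlam]
      exact min_le_left _ _
    · rw [← min_add_add_right]
      exact le_min h1 (h2.trans (by linarith))
  have h3 : τ * a ^ 2 ≤ η := by
    have := mul_le_mul_of_nonneg_left ha1 (mul_nonneg hτ ha0)
    have := mul_le_mul_of_nonneg_left hτω ha0
    linarith
  have h4 := mul_le_mul_of_nonneg_left (pow_le_pow_left₀ hD ha3 2) hτ
  have h5 := mul_nonneg hτ (sq_nonneg (a - 8 * ε))
  linarith

theorem mul_sq_div_add_le {τ ω δ ε : ℝ} (hτ : 0 < τ) (hω : 0 < ω) :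
    τ * (δ / (2 * τ * ω) + ε) ^ 2 ≤ δ ^ 2 / (2 * τ * ω ^ 2) + 2 * τ * ε ^ 2 := by
  have e : δ ^ 2 / (2 * τ * ω ^ 2) = 2 * τ * (δ / (2 * τ * ω)) ^ 2 := by field_simp
  rw [e]
  generalize δ / (2 * τ * ω) = b
  linarith [mul_nonneg hτ.le (sq_nonneg (b - ε))]

end Scalars

/-! ### The size of Θ* against ε̄_stat. -/

section Statistics

variable {d₁ d₂ : ℕ}

/-- Only the summand of ε̄_stat without the Frobenius distance is used. -/
theorem le_epsStat {q R lam : ℝ} (hR : 0 < R) (hlam : 0 < lam)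
    (A B : Matrix (Fin d₁) (Fin d₂) ℝ) :
    8 * (lam * (lam ^ (-q) * R)) ≤ epsStat q R lam A B := by
  have e1 : lam ^ (-(q / 2)) * lam ^ (1 - q / 2) = lam * lam ^ (-q) := by
    rw [← Real.rpow_add hlam, show -(q / 2) + (1 - q / 2) = 1 + -q by ring, Real.rpow_add hlam,
      Real.rpow_one]
  have e2 : R ^ (1 / 2 : ℝ) * R ^ (1 / 2 : ℝ) = R := by
    rw [← Real.rpow_add hR]; norm_num
  have h : 0 ≤ 8 * lam ^ (-(q / 2)) * R ^ (1 / 2 : ℝ) * (Real.sqrt 2 * frobNorm (A - B)) := by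
    have := frobNorm_nonneg (A - B)
    positivity
  rw [epsStat, mul_add]
  refine le_trans (le_of_eq ?_) (le_add_of_nonneg_left h)
  linear_combination -8 * R * e1 - 8 * lam ^ (-(q / 2)) * lam ^ (1 - q / 2) * e2

/-- Each nonzero σ has σ^q ≤ R < λ^q, hence σ ≤ λ and σ = σ^(1-q) σ^q ≤ λ^(1-q) σ^q. -/
theorem nucNorm_le_of_mem_lqBall {q R lam : ℝ} (hq₀ : 0 ≤ q) (hq₁ : q ≤ 1) (hlam : 0 < lam)
    (hR : R < lam ^ q) {A : Matrix (Fin d₁) (Fin d₂) ℝ} (hA : A ∈ lqBall d₁ d₂ q R) :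
    nucNorm A ≤ lam * (lam ^ (-q) * R) := by
  have hA' : ∑ j ∈ Finset.range (min d₁ d₂),
      (if singVal A j = 0 then 0 else |singVal A j| ^ q) ≤ R := hA
  have hnn : ∀ j ∈ Finset.range (min d₁ d₂),
      0 ≤ if singVal A j = 0 then 0 else |singVal A j| ^ q := fun j _ ↦ by
    split_ifs <;> positivity
  have e : lam * (lam ^ (-q) * R) = lam ^ (1 - q) * R := by
    rw [sub_eq_add_neg, Real.rpow_add hlam, Real.rpow_one, mul_assoc]
  rw [e]
  refine le_trans ?_ (mul_le_mul_of_nonneg_left hA' (by positivity))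
  rw [nucNorm, Finset.mul_sum]
  refine Finset.sum_le_sum fun j hj ↦ ?_
  have h1 := (Finset.single_le_sum hnn hj).trans hA'
  have h0 := singVal_nonneg A j
  split_ifs at h1 ⊢ with hs
  · simp [hs]
  · rw [abs_of_nonneg h0] at h1 ⊢
    have hpos : 0 < singVal A j := lt_of_le_of_ne h0 (Ne.symm hs)
    have hle : singVal A j ≤ lam := by
      by_contra! hlt
      have := Real.rpow_le_rpow hlam.le hlt.le hq₀
      linarith
    calc singVal A j = singVal A j ^ (1 - q) * singVal A j ^ q := by
          rw [← Real.rpow_add hpos]; simp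
      _ ≤ _ := mul_le_mul_of_nonneg_right
          (Real.rpow_le_rpow h0 hle (by linarith)) (by positivity)

end Statistics

/-! ### Cone condition and one-step estimates. -/

section Optimization

variable {d₁ d₂ : ℕ}

theorem nucNorm_sub_comm (A B : Matrix (Fin d₁) (Fin d₂) ℝ) :
    nucNorm (A - B) = nucNorm (B - A) := by
  rw [← nucNorm_neg, neg_sub]

theorem objective_sub_eq {Γ : Matrix (Fin d₁) (Fin d₁) ℝ} (hΓ : Γ.IsSymm)
    (Υ : Matrix (Fin d₁) (Fin d₂) ℝ) (lam : ℝ) (A B : Matrix (Fin d₁) (Fin d₂) ℝ) :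
    objective Γ Υ lam A - objective Γ Υ lam B = 1 / 2 * gramForm d₂ Γ (A - B) (A - B)
      + (gramForm d₂ Γ B (A - B) - trForm d₁ d₂ Υ (A - B)) + lam * (nucNorm A - nucNorm B) := by
  rw [objective_eq, objective_eq]
  simp only [map_sub, LinearMap.sub_apply]
  rw [gramForm_comm hΓ A B]
  ring

/-- Near-minimizers of the objective are close to `Θstar` in nuclear norm. -/
theorem nucNorm_sub_le_of_objective_sub_le {Γ : Matrix (Fin d₁) (Fin d₁) ℝ} (hΓ : Γ.IsSymm)
    {Υ : Matrix (Fin d₁) (Fin d₂) ℝ} {lam ω α₁ τ η : ℝ} (hlam : 0 < lam) (hα₁ : 0 ≤ α₁)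
    (hτ : 0 ≤ τ) (hτω : 4 * (τ * ω) ≤ lam) (hRSC : RSC d₂ Γ α₁ τ)
    {S A : Matrix (Fin d₁) (Fin d₂) ℝ} (hdev : opNorm (Υ - Γ * S) ≤ lam / 4)
    (hS : nucNorm S ≤ ω) (hA : nucNorm A ≤ ω)
    (h : objective Γ Υ lam A - objective Γ Υ lam S ≤ η) :
    nucNorm (A - S) ≤ 2 * η / lam + 4 * nucNorm S := by
  rw [objective_sub_eq hΓ] at h
  have h1 : gramForm d₂ Γ S (A - S) - trForm d₁ d₂ Υ (A - S)
      = -trInner (Υ - Γ * S) (A - S) := by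
    rw [← trForm_apply, map_sub (trForm d₁ d₂), LinearMap.sub_apply, gramForm_apply,
      trForm_apply (Γ * S)]
    ring
  have h2 := (trInner_le_opNorm_mul_nucNorm (Υ - Γ * S) (A - S)).trans
    (mul_le_mul_of_nonneg_right hdev (nucNorm_nonneg _))
  have h3 := hRSC (A - S)
  have h4 : 0 ≤ α₁ * frobNorm (A - S) ^ 2 := by positivity
  have h5 : nucNorm (A - S) ≤ 2 * ω := (nucNorm_sub_le A S).trans (by linarith)
  -- The RSC error, halved, costs (λ/4)‖A - S‖_*, as does the deviation; half of the penalty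
  -- survives.
  have h6 : τ * nucNorm (A - S) ^ 2 ≤ lam / 2 * nucNorm (A - S) := by
    have := mul_le_mul_of_nonneg_left h5 hτ
    have := mul_le_mul_of_nonneg_right this (nucNorm_nonneg (A - S))
    have := mul_le_mul_of_nonneg_right hτω (nucNorm_nonneg (A - S))
    nlinarith
  have h7 : nucNorm (A - S) ≤ nucNorm A + nucNorm S := nucNorm_sub_le A S
  have h8 := mul_le_mul_of_nonneg_left h7 hlam.le
  rw [h1, gramForm_apply] at h
  have h9 : nucNorm (A - S) * lam ≤ 2 * η + 4 * nucNorm S * lam := by linarith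
  rw [← mul_div_cancel_right₀ (4 * nucNorm S) hlam.ne', ← add_div, le_div_iff₀ hlam]
  exact h9

/-- Growth of the objective at its minimizer over the feasible region. -/
theorem IsArgMin.growth {Γ : Matrix (Fin d₁) (Fin d₁) ℝ} (hΓ : Γ.IsSymm)
    {Υ : Matrix (Fin d₁) (Fin d₂) ℝ} {lam ω : ℝ} (hlam : 0 ≤ lam)
    {X : Matrix (Fin d₁) (Fin d₂) ℝ} (hX : IsArgMin (objective Γ Υ lam) (feasible d₁ d₂ ω) X)
    {A : Matrix (Fin d₁) (Fin d₂) ℝ} (hA : A ∈ feasible d₁ d₂ ω) :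
    1 / 2 * gramForm d₂ Γ (A - X) (A - X) ≤ objective Γ Υ lam A - objective Γ Υ lam X := by
  rw [objective_sub_eq hΓ]
  linarith [hX.objective_vi hΓ hlam hA]

/-- One proximal gradient step, in matrix form. -/
theorem IsProxGradSeq.descent {Γ : Matrix (Fin d₁) (Fin d₁) ℝ} (hΓ : Γ.IsSymm)
    {Υ : Matrix (Fin d₁) (Fin d₂) ℝ} {lam ω v α₂ τ α γ e : ℝ} (hlam : 0 ≤ lam) (hv : 0 < v)
    (hα₂ : α₂ ≤ v) (hτ0 : 0 ≤ τ) (hRSM : RSM d₂ Γ α₂ τ)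
    {Θ : ℕ → Matrix (Fin d₁) (Fin d₂) ℝ} (hΘ : IsProxGradSeq Γ Υ lam ω v Θ) (t : ℕ)
    {Z : Matrix (Fin d₁) (Fin d₂) ℝ} (hZ : Z ∈ feasible d₁ d₂ ω)
    (hlow : α * frobNorm (Z - Θ t) ^ 2 - e ≤ trInner (Γ * (Z - Θ t)) (Z - Θ t))
    (hτ : τ < v) (hγ0 : 0 ≤ γ) (hγ1 : γ ≤ 1) (hγ : γ * v ^ 2 ≤ (v - τ) * α) :
    objective Γ Υ lam (Θ (t + 1)) - objective Γ Υ lam Z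
      ≤ (1 - γ) * (objective Γ Υ lam (Θ t) - objective Γ Υ lam Z) + γ / 2 * e := by
  refine prox_descent (trForm d₁ d₂) (gramForm d₂ Γ) trInner_comm trInner_self_nonneg
    (gramForm_comm hΓ) (trForm d₁ d₂ Υ) (objective_eq Γ Υ lam) (hΘ.vi hlam hv t (hΘ.mem t))
    (hΘ.vi hlam hv t hZ) ?_ ?_ hτ hγ0 hγ1 hγ
  · have h1 := RSM.quad_le hτ0 hRSM (Θ (t + 1) - Θ t)
    have h2 := mul_le_mul_of_nonneg_right hα₂ (sq_nonneg (frobNorm (Θ (t + 1) - Θ t)))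
    rw [trForm_apply, gramForm_apply, ← frobNorm_sq]
    linarith
  · rwa [trForm_apply, gramForm_apply, ← frobNorm_sq]

theorem IsProxGradSeq.contraction_of_small_tol {Γ : Matrix (Fin d₁) (Fin d₁) ℝ} (hΓ : Γ.IsSymm)
    {Υ : Matrix (Fin d₁) (Fin d₂) ℝ} {lam ω v α₁ α₂ τ g : ℝ} (hlam : 0 ≤ lam) (hα₁ : 0 < α₁)
    (hv1 : 4 * α₁ ≤ v) (hv2 : α₂ ≤ v) (hτ0 : 0 ≤ τ) (hτ : τ ≤ α₁ / 2) (hg0 : 0 < g)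
    (hg1 : g ≤ 1 / 4) (hgv : g * v = α₁) (hRSC : RSC d₂ Γ α₁ τ) (hRSM : RSM d₂ Γ α₂ τ)
    {Θ : ℕ → Matrix (Fin d₁) (Fin d₂) ℝ} (hΘ : IsProxGradSeq Γ Υ lam ω v Θ) (t : ℕ)
    {Z : Matrix (Fin d₁) (Fin d₂) ℝ} (hZ : Z ∈ feasible d₁ d₂ ω) :
    objective Γ Υ lam (Θ (t + 1)) - objective Γ Υ lam Z
      ≤ (1 - g / 4) * (objective Γ Υ lam (Θ t) - objective Γ Υ lam Z) := by
  have hquad : α₁ / 2 * frobNorm (Z - Θ t) ^ 2 ≤ trInner (Γ * (Z - Θ t)) (Z - Θ t) :=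
    (mul_le_mul_of_nonneg_right (by linarith) (sq_nonneg _)).trans (hRSC.le_quad hτ0 _)
  -- Here τ ≤ α₁/2 ≤ v/8, so v - τ ≥ v/2.
  have hγ : g / 4 * v ^ 2 ≤ (v - τ) * (α₁ / 2) := by
    have := mul_le_mul_of_nonneg_right (by linarith : v / 2 ≤ v - τ) hα₁.le
    rw [show g / 4 * v ^ 2 = g * v * v / 4 by ring, hgv]
    linarith
  have h := hΘ.descent hΓ hlam (by linarith) hv2 hτ0 hRSM t hZ (α := α₁ / 2) (γ := g / 4)
    (e := 0) (by rwa [sub_zero]) (by linarith) (by linarith) (by linarith) hγ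
  rwa [mul_zero, add_zero] at h

/-- Contraction of the optimality gap, up to the level `δ`, when the iterates lie in a cone of
nuclear norms. -/
theorem IsProxGradSeq.contraction_of_cone {Γ : Matrix (Fin d₁) (Fin d₁) ℝ} (hΓ : Γ.IsSymm)
    {Υ : Matrix (Fin d₁) (Fin d₂) ℝ} {lam ω v α₁ α₂ τ g ε δ : ℝ} (hlam : 0 < lam) (hω : 0 ≤ ω)
    (hα₁ : 0 < α₁) (hv1 : 4 * α₁ ≤ v) (hv2 : α₂ ≤ v) (hτ0 : 0 ≤ τ) (hτ : τ ≤ 5 / 8 * v)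
    (hτω : 4 * (τ * ω) ≤ lam) (hg0 : 0 < g) (hg1 : g ≤ 1 / 4) (hgv : g * v = α₁)
    (hε : 0 ≤ ε) (hδε : 1280 * (τ * ε ^ 2) ≤ δ)
    (hRSC : RSC d₂ Γ α₁ τ) (hRSM : RSM d₂ Γ α₂ τ)
    {Θ : ℕ → Matrix (Fin d₁) (Fin d₂) ℝ} (hΘ : IsProxGradSeq Γ Υ lam ω v Θ) (t : ℕ)
    {Z : Matrix (Fin d₁) (Fin d₂) ℝ} (hZ : Z ∈ feasible d₁ d₂ ω)
    (hgap : 0 ≤ objective Γ Υ lam (Θ t) - objective Γ Υ lam Z)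
    (hcone : nucNorm (Z - Θ t)
      ≤ 2 * (objective Γ Υ lam (Θ t) - objective Γ Υ lam Z) / lam + ε)
    (hnuc : nucNorm (Z - Θ t) ≤ 2 * ω) :
    objective Γ Υ lam (Θ (t + 1)) - objective Γ Υ lam Z
      ≤ (1 - g / 8) * max (objective Γ Υ lam (Θ t) - objective Γ Υ lam Z) δ := by
  have hγ : 3 / 8 * g * v ^ 2 ≤ (v - τ) * α₁ := by
    have := mul_le_mul_of_nonneg_right (by linarith : 3 / 8 * v ≤ v - τ) hα₁.le
    rw [show 3 / 8 * g * v ^ 2 = 3 / 8 * v * (g * v) by ring, hgv]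
    exact this
  have h := hΘ.descent hΓ hlam.le (by linarith) hv2 hτ0 hRSM t hZ (hRSC _) (by linarith)
    (by linarith) (by linarith) hγ
  have hD2 := mul_sq_le_of_le_add hlam hτ0 hω hτω hgap hε (nucNorm_nonneg _) hcone hnuc
  refine h.trans ?_
  generalize objective Γ Υ lam (Θ t) - objective Γ Υ lam Z = η at *
  have hmη : η ≤ max η δ := le_max_left _ _
  have hmδ : δ ≤ max η δ := le_max_right _ _
  have hm0 : 0 ≤ max η δ := hgap.trans hmη
  have h1 := mul_le_mul_of_nonneg_left hD2 hg0.le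
  have h2 := mul_le_mul_of_nonneg_left (hδε.trans hmδ) hg0.le
  -- The coefficient 27/128 = (3/16)(9/8) is the share of the RSC error proportional to η. The rate
  -- 1 - 21g/128 leaves room below 1 - g/8 for the ε² term.
  have h3 := mul_le_mul_of_nonneg_left hmη (by linarith : 0 ≤ 1 - 3 / 8 * g + 27 / 128 * g)
  have h4 := mul_nonneg hg0.le hm0
  linarith

/-- If the penalty dominates the step, one step lands near `S` in nuclear norm. -/
theorem IsProxGradSeq.nucNorm_sub_le_of_large_tol {Γ : Matrix (Fin d₁) (Fin d₁) ℝ} (hΓ : Γ.IsSymm)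
    {Υ : Matrix (Fin d₁) (Fin d₂) ℝ} {lam ω v α₁ α₂ τ : ℝ} (hlam : 0 < lam) (hv : 0 < v)
    (hω : 0 < ω) (hα₁ : 0 ≤ α₁) (hα₂ : α₂ ≤ v) (hτ : 5 / 8 * v < τ) (hτω : 4 * (τ * ω) ≤ lam)
    (hRSC : RSC d₂ Γ α₁ τ) (hRSM : RSM d₂ Γ α₂ τ)
    {Θ : ℕ → Matrix (Fin d₁) (Fin d₂) ℝ} (hΘ : IsProxGradSeq Γ Υ lam ω v Θ) (t : ℕ)
    {S : Matrix (Fin d₁) (Fin d₂) ℝ} (hS : 400 * nucNorm S ≤ ω)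
    (hdev : opNorm (Υ - Γ * S) ≤ lam / 4) :
    nucNorm (Θ (t + 1) - S) ≤ 21 * nucNorm S := by
  have hτ0 : 0 < τ := by linarith
  set m := nucNorm (Θ (t + 1) - S) with hm
  have hL := nucNorm_nonneg S
  rcases (nucNorm_nonneg (Θ (t + 1) - S)).eq_or_lt with h0 | h0
  · rw [hm, ← h0]
    positivity
  have hSmem : S ∈ feasible d₁ d₂ ω := by change nucNorm S ≤ ω; linarith
  have hvi := hΘ.vi hlam.le hv t hSmem
  -- The form v·id - Γ carries the previous iterate's influence on the next one. Its quadratic form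
  -- is bounded by τ + v, and ‖Θ^t - S‖_F ≤ ω + ω/400.
  have hbound := form_le_of_abs_quad_le (trForm d₁ d₂) (v • trForm d₁ d₂ - gramForm d₂ Γ)
    trInner_comm
    (fun A B ↦ by
      simp only [LinearMap.sub_apply, LinearMap.smul_apply, gramForm_comm hΓ A B, trForm_apply,
        trInner_comm A B])
    (by linarith : 0 ≤ τ + v) (fun A ↦ by
      have h1 := RSM.quad_le hτ0.le hRSM A
      have h2 := RSC.le_quad hτ0.le hRSC A
      have h3 := sq_nonneg (frobNorm A)
      simp only [LinearMap.sub_apply, LinearMap.smul_apply, trForm_apply, gramForm_apply,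
        smul_eq_mul, ← frobNorm_sq]
      rw [abs_le]
      constructor <;> nlinarith)
    (x := Θ t - S) (y := Θ (t + 1) - S) (M := 401 / 400 * ω) (m := m) (by positivity) h0
    (by
      rw [trForm_apply, ← frobNorm_sq]
      refine pow_le_pow_left₀ (frobNorm_nonneg _) ?_ 2
      have h1 : nucNorm (Θ t) ≤ ω := hΘ.mem t
      linarith [frobNorm_le_nucNorm (Θ t - S), nucNorm_sub_le (Θ t) S])
    (by
      rw [trForm_apply, ← frobNorm_sq]
      exact pow_le_pow_left₀ (frobNorm_nonneg _) (frobNorm_le_nucNorm _) 2)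
  have hW := (trInner_le_opNorm_mul_nucNorm (Υ - Γ * S) (Θ (t + 1) - S)).trans
    (mul_le_mul_of_nonneg_right hdev h0.le)
  have hF0 := trInner_self_nonneg (Θ (t + 1) - S)
  have htri := nucNorm_sub_le (Θ (t + 1)) S
  have hkey : lam * (nucNorm (Θ (t + 1)) - nucNorm S) + v * trForm d₁ d₂ (Θ (t + 1) - S)
      (Θ (t + 1) - S) ≤ trInner (Υ - Γ * S) (Θ (t + 1) - S)
        + (v • trForm d₁ d₂ - gramForm d₂ Γ) (Θ t - S) (Θ (t + 1) - S) := by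
    rw [← trForm_apply]
    rw [← neg_sub (Θ (t + 1)) S] at hvi
    obtain ⟨P, hP⟩ : ∃ P, Θ (t + 1) = S + P := ⟨Θ (t + 1) - S, by abel⟩
    obtain ⟨X, hX⟩ : ∃ X, Θ t = S + X := ⟨Θ t - S, by abel⟩
    rw [hP, hX] at hvi
    rw [hP, hX]
    have e : trForm d₁ d₂ (Γ * S) P = gramForm d₂ Γ S P := rfl
    simp only [add_sub_cancel_left, map_neg, map_add, map_sub, LinearMap.sub_apply,
      LinearMap.add_apply, LinearMap.smul_apply, smul_eq_mul, e] at hvi ⊢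
    linarith
  have hFv : 0 ≤ v * trForm d₁ d₂ (Θ (t + 1) - S) (Θ (t + 1) - S) := mul_nonneg hv.le hF0
  have h1 : (τ + v) * (401 / 400 * ω) ≤ 13 / 5 * (401 / 400) * (lam / 4) := by
    have : (τ + v) * ω ≤ 13 / 5 * τ * ω := mul_le_mul_of_nonneg_right (by linarith) hω.le
    nlinarith
  have h2 := mul_le_mul_of_nonneg_right h1 h0.le
  have h3 := mul_le_mul_of_nonneg_left htri hlam.le
  -- Deviation and previous iterate cost less than 0.91λm together, since τ + v ≤ 13τ/5. The penalty
  -- gives λ(m - 2‖S‖_*), so 0.09m ≤ 2‖S‖_* up to rounding; the exact constants yield 21.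
  have h4 : lam * m ≤ lam * (21 * nucNorm S) := by
    have := mul_nonneg hlam.le hL
    nlinarith
  exact le_of_mul_le_mul_left h4 hlam

end Optimization

end LowRankEIV

/-! ### The three regimes combined. -/

open LowRankEIV in
theorem theorem2 (n d₁ d₂ : ℕ) (hn : 0 < n)
    (q R ω lam α₁ α₂ τ φ v : ℝ)
    (hq₀ : 0 ≤ q) (hq₁ : q ≤ 1) (hR : 0 < R) (hω : 0 < ω) (hlam : 0 < lam)
    (hα₁ : 0 < α₁) (hα₂ : 0 < α₂) (hτ : 0 < τ)
    -- the surrogate matrices, the true parameter and the global solution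
    (Γ : Matrix (Fin d₁) (Fin d₁) ℝ) (hΓ : Γ.IsSymm) (Υ : Matrix (Fin d₁) (Fin d₂) ℝ)
    (Θstar Θhat : Matrix (Fin d₁) (Fin d₂) ℝ)
    (hstar : Θstar ∈ lqBall d₁ d₂ q R ∩ feasible d₁ d₂ ω)
    (hhat : IsArgMin (objective Γ Υ lam) (feasible d₁ d₂ ω) Θhat)
    -- deviation condition
    (hdev : opNorm (Υ - Γ * Θstar) ≤ φ * Real.sqrt (max (d₁ : ℝ) d₂ / n))
    (hRSC : RSC d₂ Γ α₁ τ) (hRSM : RSM d₂ Γ α₂ τ)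
    (hτle : τ ≤ φ / ω * Real.sqrt (max (d₁ : ℝ) d₂ / n))
    -- the iterates
    (Θ : ℕ → Matrix (Fin d₁) (Fin d₂) ℝ) (hΘ : IsProxGradSeq Γ Υ lam ω v Θ)
    (hv : max (4 * α₁) α₂ ≤ v)
    -- `lam ≥ (128 τ R / α₁) ^ (1 / q)`, in a form that also makes sense for `q = 0`
    (hlam₁ : 128 * τ * R / α₁ ≤ lam ^ q)
    (hlam₂ : 4 * φ * Real.sqrt (max (d₁ : ℝ) d₂ / n) ≤ lam)
    (hκ : kappa α₁ τ v q R lam ∈ Set.Ioo (0 : ℝ) 1)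
    (δ : ℝ)
    (hδ : 8 * xi α₁ τ v q R lam / (1 - kappa α₁ τ v q R lam) * epsStat q R lam Θhat Θstar ^ 2 ≤ δ)
    (t : ℕ)
    (ht : iterCount (kappa α₁ τ v q R lam) ω lam
      (objective Γ Υ lam (Θ 0) - objective Γ Υ lam Θhat) δ ≤ t) :
    frobNorm (Θ t - Θhat) ^ 2 ≤
      4 / α₁ * (δ + δ ^ 2 / (2 * τ * ω ^ 2) + 2 * τ * epsStat q R lam Θhat Θstar ^ 2) := by
  have hv1 : 4 * α₁ ≤ v := (le_max_left _ _).trans hv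
  have hv2 : α₂ ≤ v := (le_max_right _ _).trans hv
  have hv0 : 0 < v := by linarith
  obtain ⟨hs, hκge, hξ⟩ := kappa_bounds hα₁ hτ hv1 hR hlam hκ
  have hε := le_epsStat (q := q) hR hlam Θhat Θstar
  set κ := kappa α₁ τ v q R lam
  set ξ := xi α₁ τ v q R lam
  set ε := epsStat q R lam Θhat Θstar
  set Ψ := objective Γ Υ lam
  set s := lam ^ (-q) * R with hs_def
  have hs0 : 0 < s := by positivity
  have hε0 : 0 < ε := by nlinarith [mul_pos hlam hs0]
  set g := α₁ / v with hg
  have hg0 : 0 < g := div_pos hα₁ hv0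
  have hgv : g * v = α₁ := div_mul_cancel₀ _ hv0.ne'
  have hg1 : g ≤ 1 / 4 := by rw [hg, div_le_iff₀ hv0]; linarith
  have hg8 : α₁ / (8 * v) = g / 8 := by rw [hg]; field_simp
  rw [hg8] at hκge
  clear_value κ ξ ε s g
  have h1κ : 0 < 1 - κ := sub_pos.mpr hκ.2
  -- 1280 = 40 · 32, from 8ξ ≥ 40τ and 1 - κ ≤ g/8 ≤ 1/32.
  have hδε : 1280 * (τ * ε ^ 2) ≤ δ := by
    refine le_trans ?_ hδ
    rw [← mul_assoc]
    refine mul_le_mul_of_nonneg_right ?_ (sq_nonneg ε)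
    rw [le_div_iff₀ h1κ]
    nlinarith
  have hδ0 : 0 < δ := lt_of_lt_of_le (by positivity) hδε
  -- the deviation bounds in terms of `lam`
  have hτω : 4 * (τ * ω) ≤ lam := by
    have := mul_le_mul_of_nonneg_right hτle hω.le
    have e : φ / ω * Real.sqrt (max (d₁ : ℝ) d₂ / n) * ω
        = φ * Real.sqrt (max (d₁ : ℝ) d₂ / n) := by field_simp
    linarith
  have hdev' : opNorm (Υ - Γ * Θstar) ≤ lam / 4 := by linarith
  have hgap : ∀ t, 0 ≤ Ψ (Θ t) - Ψ Θhat := fun t ↦ sub_nonneg.mpr (hhat.2 _ (hΘ.mem t))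
  have hinit := le_of_iterCount_le hκ (hgap 0) hδ0 ht
  have hsq0 : 0 ≤ δ ^ 2 / (2 * τ * ω ^ 2) := by positivity
  have hτε : 0 ≤ 2 * τ * ε ^ 2 := by positivity
  have htarget : ∀ {x : ℝ}, α₁ * x ≤ 4 * (δ + δ ^ 2 / (2 * τ * ω ^ 2) + 2 * τ * ε ^ 2) →
      x ≤ 4 / α₁ * (δ + δ ^ 2 / (2 * τ * ω ^ 2) + 2 * τ * ε ^ 2) := fun {x} h ↦ by
    rw [div_mul_eq_mul_div, le_div_iff₀ hα₁]
    linarith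
  have hcontr : (∀ t, Ψ (Θ (t + 1)) - Ψ Θhat ≤ κ * max (Ψ (Θ t) - Ψ Θhat) δ) →
      Ψ (Θ t) - Ψ Θhat ≤ δ := fun h ↦
    (le_max_of_contraction hκ.1.le hκ.2.le hδ0.le (η := fun t ↦ Ψ (Θ t) - Ψ Θhat) h t).trans
      (max_le hinit le_rfl)
  have hgrowth : 1 / 2 * trInner (Γ * (Θ t - Θhat)) (Θ t - Θhat) ≤ Ψ (Θ t) - Ψ Θhat :=
    hhat.growth hΓ hlam.le (hΘ.mem t)
  refine htarget ?_
  rcases le_or_gt τ (α₁ / 2) with hτα | hτα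
  · -- small tolerance: the loss is strongly convex
    have hquad : ∀ A : Matrix (Fin d₁) (Fin d₂) ℝ,
        α₁ / 2 * frobNorm A ^ 2 ≤ trInner (Γ * A) A := fun A ↦
      (mul_le_mul_of_nonneg_right (by linarith) (sq_nonneg _)).trans (hRSC.le_quad hτ.le A)
    have hle := hcontr fun t ↦
      (hΘ.contraction_of_small_tol hΓ hlam.le hα₁ hv1 hv2 hτ.le hτα hg0 hg1 hgv hRSC hRSM t
        hhat.1).trans (mul_le_mul (by linarith) (le_max_left _ _) (hgap t) hκ.1.le)
    have := hquad (Θ t - Θhat)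
    linarith
  -- large tolerance: `Θstar` is small in nuclear norm
  have hs1 : s < 1 := by
    by_contra! h
    nlinarith
  have hRlt : R < lam ^ q := by
    have hp := Real.rpow_pos_of_pos hlam q
    rw [hs_def, Real.rpow_neg hlam.le, inv_mul_lt_iff₀ hp, mul_one] at hs1
    exact hs1
  have hL := nucNorm_le_of_mem_lqBall hq₀ hq₁ hlam hRlt hstar.1
  rw [← hs_def] at hL
  have hL0 := nucNorm_nonneg Θstar
  have hLε : 8 * nucNorm Θstar ≤ ε := by linarith
  have hLω : nucNorm Θstar ≤ ω := hstar.2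
  have hnuc2 : ∀ t, nucNorm (Θhat - Θ t) ≤ 2 * ω := fun t ↦ by
    have h1 : nucNorm Θhat ≤ ω := hhat.1
    have h2 : nucNorm (Θ t) ≤ ω := hΘ.mem t
    linarith [nucNorm_sub_le Θhat (Θ t)]
  have hhatstar : nucNorm (Θhat - Θstar) ≤ 4 * nucNorm Θstar := by
    have := nucNorm_sub_le_of_objective_sub_le hΓ hlam hα₁.le hτ.le hτω hRSC hdev' hLω hhat.1
      (η := 0) (sub_nonpos.mpr (hhat.2 _ hstar.2))
    simpa using this
  have hcone : ∀ t, nucNorm (Θhat - Θ t) ≤ 2 * (Ψ (Θ t) - Ψ Θhat) / lam + ε := fun t ↦ by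
    have h1 := nucNorm_sub_le_of_objective_sub_le hΓ hlam hα₁.le hτ.le hτω hRSC hdev' hLω
      (hΘ.mem t) (η := Ψ (Θ t) - Ψ Θhat) (sub_le_sub_left (hhat.2 _ hstar.2) _)
    have h2 := nucNorm_sub_le (Θhat - Θstar) (Θ t - Θstar)
    rw [sub_sub_sub_cancel_right] at h2
    linarith
  have hfinal : Ψ (Θ t) - Ψ Θhat ≤ δ →
      α₁ * frobNorm (Θ t - Θhat) ^ 2
        ≤ 4 * (δ + δ ^ 2 / (2 * τ * ω ^ 2) + 2 * τ * ε ^ 2) := fun h ↦ by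
    have h1 := hRSC (Θ t - Θhat)
    rw [nucNorm_sub_comm] at h1
    have h2 : nucNorm (Θhat - Θ t) ≤ δ / (2 * τ * ω) + ε := by
      refine (hcone t).trans (add_le_add_left ?_ _)
      rw [div_le_div_iff₀ hlam (by positivity)]
      have := mul_le_mul_of_nonneg_left hτω hδ0.le
      have := mul_le_mul_of_nonneg_right h (by positivity : 0 ≤ τ * ω)
      linarith
    have h3 := pow_le_pow_left₀ (nucNorm_nonneg _) h2 2
    have h4 := mul_sq_div_add_le hτ hω (δ := δ) (ε := ε)
    have h5 := mul_le_mul_of_nonneg_left h3 hτ.le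
    linarith
  rcases le_or_gt τ (5 / 8 * v) with hτv | hτv
  · -- the step size dominates the tolerance
    exact hfinal (hcontr fun t ↦
      (hΘ.contraction_of_cone hΓ hlam hω.le hα₁ hv1 hv2 hτ.le hτv hτω hg0 hg1 hgv hε0.le hδε hRSC
        hRSM t hhat.1 (hgap t) (hcone t) (hnuc2 t)).trans
      (mul_le_mul_of_nonneg_right hκge ((hgap t).trans (le_max_left _ _))))
  · -- the penalty dominates the step
    cases t with
    -- No step has been taken, but then `hinit` says that the initial gap is already at most δ.
    | zero => exact hfinal (by simpa using hinit)
    | succ t =>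
      have hF := pow_le_pow_left₀ (frobNorm_nonneg _)
        (frobNorm_le_nucNorm (Θ (t + 1) - Θhat)) 2
      rw [nucNorm_sub_comm] at hF
      have hF' := mul_le_mul_of_nonneg_left hF hα₁.le
      -- For large δ the diameter 2ω is enough. For small δ, Θ* is tiny compared with ω, as the
      -- one-step estimate requires.
      rcases le_or_gt (α₁ * ω ^ 2) δ with hδω | hδω
      · have h1 := mul_le_mul_of_nonneg_left
          (pow_le_pow_left₀ (nucNorm_nonneg _) (hnuc2 (t + 1)) 2) hα₁.le
        linarith
      · have hε2 : 64 * nucNorm Θstar ^ 2 ≤ ε ^ 2 := by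
          have := pow_le_pow_left₀ (by positivity) hLε 2
          linarith
        have hLτ := mul_le_mul_of_nonneg_left hε2 hτ.le
        -- 1280 · 64 τ‖Θ*‖_*² ≤ δ < α₁ω² ≤ (2/5)τω², and 1280 · 64 · 5/2 exceeds 400².
        have hsmall : 400 * nucNorm Θstar ≤ ω := by
          refine le_of_sq_le_sq ?_ hω.le
          have h1 : α₁ * ω ^ 2 ≤ 2 / 5 * τ * ω ^ 2 :=
            mul_le_mul_of_nonneg_right (by linarith) (sq_nonneg ω)
          refine le_of_mul_le_mul_left ?_ hτ
          linarith [mul_nonneg hτ.le (sq_nonneg ω)]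
        have hstep := hΘ.nucNorm_sub_le_of_large_tol hΓ hlam hv0 hω hα₁.le hv2 hτv hτω hRSC hRSM t
          hsmall hdev'
        have htri := nucNorm_sub_le (Θhat - Θstar) (Θ (t + 1) - Θstar)
        rw [sub_sub_sub_cancel_right] at htri
        have h25 : nucNorm (Θhat - Θ (t + 1)) ≤ 25 * nucNorm Θstar := by linarith
        have h1 := mul_le_mul_of_nonneg_left
          (pow_le_pow_left₀ (nucNorm_nonneg _) h25 2) hα₁.le
        have h2 : α₁ * nucNorm Θstar ^ 2 ≤ 2 * τ * nucNorm Θstar ^ 2 :=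
          mul_le_mul_of_nonneg_right (by linarith) (sq_nonneg _)
        linarith [mul_nonneg hτ.le (sq_nonneg ε)]
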